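/- Let $A$ be a finite alphabet, $A^*$ the set of finite words over $A$, $A^+ = A^* \setminus \{\varepsilon\}$, and let $\sigma : A \to A^+$ be a substitution (a non-erasing morphism of $A^*$), acting also on $A^{\mathbb Z}$ by concatenation, the image of $x_0$ starting at index $0$. A letter $a$ is bounded if the lengths $(|\sigma^n(a)|)_{n \ge 0}$ are bounded and growing otherwise; $B$ and $C$ denote the sets of bounded and of growing letters. A subshift is a non-empty set $X \subset A^{\mathbb Z}$, closed for the prodiscrete topology, with $T(X) = X$, where $T(x)_i = x_{i+1}$. The language $\mathscr L(\sigma)$ is the set of factors of the words $\sigma^n(a)$ ($a \in A$, $n \ge 0$), and $X_\sigma$ is the set of $x \in A^{\mathbb Z}$ all of whose finite factors are in $\mathscr L(\sigma)$. For $X \subset A^{\mathbb Z}$, $alph_C(X)$ is the set of growing letters occurring in elements of $X$, and $$\tilde\sigma(X) := \{T^k(\sigma(x)) \mid x \in X,\ k \in \mathbb Z\}.$$ For non-empty $D \subset C$, write $D \to D'$ if $D'$ is the set of growing letters occurring in the words $\sigma(a)$, $a \in D$, and $D \xrightarrow[k]{} D'$ if there is a path of $k$ such arrows from $D$ to $D'$.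 $D$ is a $k$-periodic alphabet if $k$ is the smallest positive integer with $D \xrightarrow[k]{} D$. If $\tau = \sigma^k$ satisfies $\tau(S) \subset S^+$ for a subalphabet $S \subset A$, then $\tau|_S : S \to S^+$ is its restriction and $X_{\tau|_S} \subset S^{\mathbb Z} \subset A^{\mathbb Z}$. Proposition. For every subshift $X \subset X_\sigma$ there is $k \ge 1$ such that $\tilde\sigma^k(X) = X$ and, if in addition $D := alph_C(X) \ne \emptyset$, the following hold: (a) $D \xrightarrow[k]{} D$, the restriction $\sigma^k|_{D \cup B}$ is well defined, and $X_{\sigma^k|_{D \cup B}} \subset X$; (b) $D$ is a $p$-periodic alphabet for some $p \ge 1$ dividing $k$, the restriction $\sigma^p|_{D \cup B}$ is well defined, and $X_{\sigma^p|_{D \cup B}} \subset X$. Moreover, $\tilde\sigma$ restricts to a bijection from the set of subshifts contained in $X_\sigma$ onto itself. -/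

import Mathlib

/-! ### Bi-infinite words and subshifts -/

namespace BiWord

variable {A : Type*}

/-- The word `x_i x_{i+1} ... x_{i+n-1}` of length `n`. -/
def window (x : ℤ → A) (i : ℤ) (n : ℕ) : List A :=
  (List.range n).map fun (j : ℕ) => x (i + (j : ℤ))

theorem length_window (x : ℤ → A) (i : ℤ) (n : ℕ) : (window x i n).length = n := by
  simp [window]

/-- The finite word `u` (possibly empty) is a factor of the bi-infinite word `x`. -/
def IsFactor (u : List A) (x : ℤ → A) : Prop :=
  ∃ (i : ℤ) (n : ℕ), u = window x i n

/-- The power `T ^ k` (`k : ℤ`) of the left shift `(T x)_i = x_{i+1}`. -/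
def shift (k : ℤ) (x : ℤ → A) : ℤ → A := fun i => x (i + k)

/-- A subshift: a non-empty set, closed for the product topology (`A` is meant to carry the
discrete topology), with `T(X) = X`. -/
def IsSubshift [TopologicalSpace A] (X : Set (ℤ → A)) : Prop :=
  X.Nonempty ∧ IsClosed X ∧ shift 1 '' X = X

end BiWord

/-! ### Substitutions -/

/-- A substitution `σ : A → A⁺`, i.e. a non-erasing morphism, given by the images of letters. -/
structure Substitution (A : Type*) where
  /-- the image of a letter -/
  letter : A → List A
  nonerasing : ∀ a, letter a ≠ []

namespace Substitution

variable {A : Type*}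

/-- The morphism `A* → A*` defined by `σ`. -/
def onWord (σ : Substitution A) (u : List A) : List A := u.flatMap σ.letter

theorem length_le_onWord (σ : Substitution A) (u : List A) :
    u.length ≤ (σ.onWord u).length := by
  induction u with
  | nil => simp
  | cons a u ih =>
    have h : 0 < (σ.letter a).length := List.length_pos_iff.2 (σ.nonerasing a)
    simp only [onWord, List.flatMap_cons, List.length_append, List.length_cons] at ih ⊢
    omega

theorem length_le_iterate (σ : Substitution A) (k : ℕ) (u : List A) :
    u.length ≤ (σ.onWord^[k] u).length := by
  induction k generalizing u with
  | zero => simp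
  | succ k ih => exact (σ.length_le_onWord u).trans (ih (σ.onWord u))

/-- The power `σ ^ k`, as a substitution. -/
def pow (σ : Substitution A) (k : ℕ) : Substitution A where
  letter a := σ.onWord^[k] [a]
  nonerasing a h := by
    have := σ.length_le_iterate k [a]
    simp [h] at this

/-- `σ(S) ⊆ S⁺` for the subalphabet `S`. -/
def Preserves (σ : Substitution A) (S : Set A) : Prop :=
  ∀ a ∈ S, ∀ b ∈ σ.letter a, b ∈ S

/-- The restriction `σ|_S : S → S⁺`. -/
def restrict (σ : Substitution A) (S : Set A) (h : σ.Preserves S) : Substitution S where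
  letter a := (σ.letter a).attachWith (· ∈ S) (h a a.2)
  nonerasing a h0 := σ.nonerasing a (by simpa using h0)

/-- The language of `σ`: the factors of the words `σ^n(a)`, `a ∈ A`, `n ≥ 0`. -/
def language (σ : Substitution A) : Set (List A) :=
  {u | ∃ (a : A) (n : ℕ), u <:+: σ.onWord^[n] [a]}

/-- The substitution subshift `X_σ`. -/
def subshift (σ : Substitution A) : Set (ℤ → A) :=
  {x | ∀ u, BiWord.IsFactor u x → u ∈ σ.language}

/-- `X_{σ|_S}`, seen as a set of bi-infinite words over the whole alphabet `A`. -/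
def restrictSubshift (σ : Substitution A) (S : Set A) (h : σ.Preserves S) : Set (ℤ → A) :=
  (fun (x : ℤ → S) (i : ℤ) => (x i : A)) '' (σ.restrict S h).subshift

/-- The set `B` of bounded letters. -/
def boundedLetters (σ : Substitution A) : Set A :=
  {a | ∃ M : ℕ, ∀ n : ℕ, (σ.onWord^[n] [a]).length ≤ M}

/-- The set `C` of growing letters. -/
def growingLetters (σ : Substitution A) : Set A := σ.boundedLettersᶜ

/-- The growing letters occurring in a finite word. -/
def alphWord (σ : Substitution A) (u : List A) : Set A :=
  {c | c ∈ σ.growingLetters ∧ c ∈ u}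

/-- The growing letters occurring in a set of bi-infinite words. -/
def alphC (σ : Substitution A) (X : Set (ℤ → A)) : Set A :=
  {c | c ∈ σ.growingLetters ∧ ∃ x ∈ X, BiWord.IsFactor [c] x}

/-- The bi-infinite word `σ(x) = ⋯ σ(x₋₂) σ(x₋₁) . σ(x₀) σ(x₁) ⋯`, where `σ(x₀)` starts at
index `0`. Its letter at `m ≥ 0` is read in `σ(x₀ ⋯ x_m)`, which has length at least `m + 1`;
its letter at `-(m+1)` is read, from the right end, in `σ(x_{-(m+1)} ⋯ x₋₁)`. -/
def onBiWord (σ : Substitution A) (x : ℤ → A) : ℤ → A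
  | Int.ofNat m =>
    (σ.onWord (BiWord.window x 0 (m + 1)))[m]'(by
      have := σ.length_le_onWord (BiWord.window x 0 (m + 1))
      rw [BiWord.length_window] at this
      omega)
  | Int.negSucc m =>
    (σ.onWord (BiWord.window x (Int.negSucc m) (m + 1))).reverse[m]'(by
      have := σ.length_le_onWord (BiWord.window x (Int.negSucc m) (m + 1))
      rw [BiWord.length_window] at this
      rw [List.length_reverse]
      omega)

/-- The map `X ↦ {T^k(σ(x)) | x ∈ X, k ∈ ℤ}` induced by `σ`. -/
def tilde (σ : Substitution A) (X : Set (ℤ → A)) : Set (ℤ → A) :=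
  {y | ∃ x ∈ X, ∃ k : ℤ, y = BiWord.shift k (σ.onBiWord x)}

/-! ### The graph of subalphabets of growing letters -/

/-- The edge `D → D'` of the graph on the non-empty sets of growing letters:
`D'` is the set of growing letters occurring in the words `σ(a)`, `a ∈ D`. -/
def Arrow (σ : Substitution A) (D D' : Set A) : Prop :=
  D ⊆ σ.growingLetters ∧ D.Nonempty ∧ D' = ⋃ a ∈ D, σ.alphWord (σ.letter a)

/-- There is a path of `k` edges from `D` to `D'`. -/
def ArrowPow (σ : Substitution A) : ℕ → Set A → Set A → Prop
  | 0, D, D' => D = D'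
  | k + 1, D, D' => ∃ E, σ.Arrow D E ∧ ArrowPow σ k E D'

/-- `D` is a `k`-periodic alphabet: `k` is the smallest positive integer such that there is a
path of `k` edges from `D` to itself. -/
def IsPeriodicAlphabet (σ : Substitution A) (k : ℕ) (D : Set A) : Prop :=
  IsLeast {n : ℕ | 1 ≤ n ∧ σ.ArrowPow n D D} k

end Substitution

/-! The crux is a period `P` common to all subshifts `X ⊆ X_σ`. A subshift is determined by its
language, and the language of `σ̃(X)` consists of the factors of the words `σ(v)`, `v ∈ lang X`. As
`σ` is non-erasing, the words of length `l` in `lang (σ̃ X)` depend only on those in `lang X`, so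
`σ̃` acts on languages of length `l` through a self-map of a finite set. Desubstitution by
compactness makes `σ̃` surjective on the subshifts of `X_σ`, hence each of these finite languages is
periodic, but with a period that may depend on `l`.

For a uniform period, choose `P` so that one-letter languages are invariant under `σ̃^P` and `τ =
σ^P` has idempotent first-letter and last-letter maps. Then the ends of given length of `τ^N(a)` are
constant for large `N`. Write `X = σ̃^(PN)(Y)`. A word of `lang X` occurs in some `τ^N(v)`, `v ∈
lang Y`. Either it lies in the image of one letter, which also occurs in `σ̃^P(Y)`, or it straddles
a boundary between images, where `τ^N` and `τ^(N+1)` look the same. Both ways it belongs to `lang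
(σ̃^P X)` (`exists_lang_subset_lang_iterate_tilde`). So languages increase along the iterates of
`σ̃^P`, and periodicity at each length forces equality (`exists_iterate_tilde_eq_self`). Bijectivity
of `σ̃` follows.

For (a) and (b), `alphC` intertwines `σ̃` with the arrow map, so `D` is periodic. Long factors of
`X_{σ^p|D ∪ B}` come from letters of `D`, and pulling these letters back along the period of `D`
places the factors in the language of `X` (`restrictSubshift_subset`). -/

namespace BiWord

variable {A : Type*}

/-! ### Windows, factors and languages of bi-infinite words. -/

theorem window_add (x : ℤ → A) (i : ℤ) (m n : ℕ) :
    window x i (m + n) = window x i m ++ window x (i + m) n := by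
  simp [window, List.range_add, Function.comp_def, add_assoc]

theorem window_shift (k : ℤ) (x : ℤ → A) (i : ℤ) (n : ℕ) :
    window (shift k x) i n = window x (i + k) n := by
  simp only [window, shift]
  exact List.map_congr_left fun j _ => by ring_nf

theorem window_congr {x y : ℤ → A} {i j : ℤ} {n : ℕ}
    (h : ∀ m : ℕ, m < n → x (i + m) = y (j + m)) : window x i n = window y j n :=
  List.map_congr_left fun m hm => h m (List.mem_range.1 hm)

theorem window_eq_iff {x y : ℤ → A} {i j : ℤ} {n : ℕ} :
    window x i n = window y j n ↔ ∀ m : ℕ, m < n → x (i + m) = y (j + m) := by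
  simp [window]

theorem window_eq_of_getElem {x : ℤ → A} {i : ℤ} {u : List A}
    (h : ∀ (m : ℕ) (hm : m < u.length), x (i + m) = u[m]) : window x i u.length = u :=
  List.ext_getElem (length_window _ _ _) fun m h₁ h₂ => by simpa [window] using h m h₂

theorem isFactor_window (x : ℤ → A) (i : ℤ) (n : ℕ) : IsFactor (window x i n) x := ⟨i, n, rfl⟩

theorem IsFactor.of_infix {u v : List A} {x : ℤ → A} (hv : IsFactor v x) (h : u <:+: v) :
    IsFactor u x := by
  obtain ⟨s, t, rfl⟩ := h
  obtain ⟨i, n, h⟩ := hv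
  obtain rfl : s.length + u.length + t.length = n := by
    simpa [length_window, add_assoc] using congrArg List.length h
  rw [window_add, window_add] at h
  have h₁ := (List.append_inj h (by simp [length_window])).1
  exact ⟨_, _, (List.append_inj h₁ (by simp [length_window])).2⟩

theorem window_infix_window (x : ℤ → A) {i j : ℤ} {m n : ℕ} (h₁ : j ≤ i) (h₂ : i + m ≤ j + n) :
    window x i m <:+: window x j n := by
  obtain ⟨a, rfl⟩ : ∃ a : ℕ, i = j + a := ⟨(i - j).toNat, by omega⟩
  obtain ⟨b, rfl⟩ : ∃ b : ℕ, n = a + m + b := ⟨n - a - m, by omega⟩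
  exact ⟨window x j a, _, by rw [window_add, window_add]⟩

theorem IsFactor.eventually_infix {u : List A} {x : ℤ → A} (h : IsFactor u x) :
    ∀ᶠ N : ℕ in Filter.atTop, u <:+: window x (-N) (N + N) := by
  obtain ⟨i, n, rfl⟩ := h
  filter_upwards [Filter.eventually_ge_atTop (i.natAbs + n)] with N hN
  exact window_infix_window x (by omega) (by push_cast; omega)

theorem isFactor_shift {u : List A} {x : ℤ → A} {k : ℤ} :
    IsFactor u (shift k x) ↔ IsFactor u x := by
  constructor
  · rintro ⟨i, n, rfl⟩
    exact ⟨i + k, n, window_shift k x i n⟩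
  · rintro ⟨i, n, rfl⟩
    exact ⟨i - k, n, by rw [window_shift]; simp⟩

theorem shift_shift (k l : ℤ) (x : ℤ → A) : shift k (shift l x) = shift (k + l) x := by
  funext i
  simp [shift, add_assoc]

theorem shift_zero (x : ℤ → A) : shift 0 x = x := by
  funext i
  simp [shift]

/-- The language of a set of bi-infinite words. -/
def lang (X : Set (ℤ → A)) : Set (List A) := {u | ∃ x ∈ X, IsFactor u x}

theorem lang_of_infix {X : Set (ℤ → A)} {u v : List A} (hv : v ∈ lang X) (h : u <:+: v) :
    u ∈ lang X := by
  obtain ⟨x, hx, hv⟩ := hv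
  exact ⟨x, hx, hv.of_infix h⟩

theorem lang_mono {X Y : Set (ℤ → A)} (h : X ⊆ Y) : lang X ⊆ lang Y :=
  fun _ ⟨x, hx, hu⟩ => ⟨x, h hx, hu⟩

section Topology

variable [TopologicalSpace A]

theorem IsSubshift.shift_mem {X : Set (ℤ → A)} (hX : IsSubshift X) {x : ℤ → A} (hx : x ∈ X)
    (k : ℤ) : shift k x ∈ X := by
  have h₁ : ∀ y ∈ X, shift 1 y ∈ X := fun y hy => hX.2.2 ▸ Set.mem_image_of_mem _ hy
  have h₂ : ∀ y ∈ X, shift (-1) y ∈ X := by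
    intro y hy
    rw [← hX.2.2] at hy
    obtain ⟨z, hz, rfl⟩ := hy
    simpa [shift_shift, shift_zero] using hz
  induction k with
  | zero => simpa [shift_zero] using hx
  | succ n ih => simpa [shift_shift, add_comm] using h₁ _ ih
  | pred n ih => simpa [shift_shift, add_comm, sub_eq_add_neg] using h₂ _ ih

theorem isSubshift_of_shift_mem {X : Set (ℤ → A)} (h₀ : X.Nonempty) (h₁ : IsClosed X)
    (h₂ : ∀ x ∈ X, ∀ k, shift k x ∈ X) : IsSubshift X := by
  refine ⟨h₀, h₁, Set.Subset.antisymm ?_ fun x hx => ⟨shift (-1) x, h₂ x hx _, ?_⟩⟩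
  · rintro _ ⟨x, hx, rfl⟩
    exact h₂ x hx 1
  · simp [shift_shift, shift_zero]

/-- Each centred window of `x` occurs in a point of `X`; shifting that point aligns the occurrence,
and the points so obtained converge to `x`. -/
theorem IsSubshift.mem_of_isFactor {X : Set (ℤ → A)} (hX : IsSubshift X) {x : ℤ → A}
    (h : ∀ u, IsFactor u x → u ∈ lang X) : x ∈ X := by
  have (N : ℕ) : ∃ y ∈ X, window x (-N) (N + N) = window y (-N) (N + N) := by
    obtain ⟨y, hy, i, n, e⟩ := h _ (isFactor_window x (-N) (N + N))
    obtain rfl : N + N = n := by simpa [length_window] using congrArg List.length e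
    exact ⟨shift (i + N) y, hX.shift_mem hy _, by rw [e, window_shift]; ring_nf⟩
  choose y hy e using this
  refine hX.2.1.mem_of_tendsto (b := Filter.atTop) (f := y) ?_ (Filter.Eventually.of_forall hy)
  refine tendsto_pi_nhds.2 fun i => tendsto_const_nhds.congr' ?_
  filter_upwards [Filter.eventually_gt_atTop i.natAbs] with N hN
  have := window_eq_iff.1 (e N) (i + N).toNat (by omega)
  rwa [show (-(N : ℤ) + ((i + N).toNat : ℤ)) = i by omega] at this

theorem IsSubshift.subset_of_lang_subset {X Y : Set (ℤ → A)} (hY : IsSubshift Y)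
    (h : lang X ⊆ lang Y) : X ⊆ Y :=
  fun x hx => hY.mem_of_isFactor fun _ hu => h ⟨x, hx, hu⟩

theorem eventually_window_eq [DiscreteTopology A] (x : ℤ → A) (i : ℤ) (n : ℕ) :
    ∀ᶠ y in nhds x, window y i n = window x i n := by
  have : ∀ᶠ y in nhds x, ∀ m ∈ Finset.range n, y (i + m) = x (i + m) := by
    rw [Filter.eventually_all_finset]
    intro m _
    have h := (continuous_apply (i + (m : ℤ)) : Continuous fun y : ℤ → A => y (i + m)).continuousAt
      (x := x)
    exact h.eventually (p := fun a => a = x (i + m)) (by simp [nhds_discrete])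
  filter_upwards [this] with y hy
  exact window_congr fun m hm => hy m (Finset.mem_range.2 hm)

/-- The words all of whose factors belong to `L` form a closed set. -/
theorem isClosed_setOf_isFactor [DiscreteTopology A] (L : Set (List A)) :
    IsClosed {x : ℤ → A | ∀ u, IsFactor u x → u ∈ L} := by
  rw [← isOpen_compl_iff, isOpen_iff_mem_nhds]
  intro x hx
  simp only [Set.mem_compl_iff, Set.mem_ofPred_eq, not_forall] at hx
  obtain ⟨u, ⟨i, n, rfl⟩, hu⟩ := hx
  filter_upwards [eventually_window_eq x i n] with y hy h
  exact hu (hy ▸ h _ (isFactor_window y i n))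

theorem lang_closure [DiscreteTopology A] (X : Set (ℤ → A)) : lang (closure X) = lang X := by
  refine Set.Subset.antisymm ?_ (lang_mono subset_closure)
  rintro u ⟨x, hx, i, n, rfl⟩
  obtain ⟨y, hy, hyX⟩ := mem_closure_iff_nhds.1 hx _ (eventually_window_eq x i n)
  exact ⟨y, hyX, i, n, hy.symm⟩

end Topology

end BiWord

/-! ### Images of bi-infinite words and the language of `σ̃(X)`. -/

namespace Substitution

open BiWord

variable {A : Type*} (σ : Substitution A)

theorem onWord_append (u v : List A) : σ.onWord (u ++ v) = σ.onWord u ++ σ.onWord v :=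
  List.flatMap_append

theorem onWord_singleton (a : A) : σ.onWord [a] = σ.letter a := by simp [onWord]

theorem mem_onWord {b : A} {u : List A} : b ∈ σ.onWord u ↔ ∃ a ∈ u, b ∈ σ.letter a :=
  List.mem_flatMap

theorem iterate_append (n : ℕ) (u v : List A) :
    σ.onWord^[n] (u ++ v) = σ.onWord^[n] u ++ σ.onWord^[n] v := by
  induction n generalizing u v with
  | zero => rfl
  | succ n ih => simp [Function.iterate_succ_apply, onWord_append, ih]

theorem iterate_nil (n : ℕ) : σ.onWord^[n] [] = [] :=
  Function.iterate_fixed rfl n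

theorem iterate_infix (n : ℕ) {u v : List A} (h : u <:+: v) :
    σ.onWord^[n] u <:+: σ.onWord^[n] v := by
  obtain ⟨s, t, rfl⟩ := h
  exact ⟨_, _, by rw [iterate_append, iterate_append]⟩

theorem onWord_infix {u v : List A} (h : u <:+: v) : σ.onWord u <:+: σ.onWord v :=
  σ.iterate_infix 1 h

theorem onWord_pow (k : ℕ) : (σ.pow k).onWord = σ.onWord^[k] := by
  funext u
  induction u with
  | nil => simp [onWord, iterate_nil]
  | cons a u ih =>
    change (σ.pow k).letter a ++ (σ.pow k).onWord u = _
    rw [ih, ← List.singleton_append, iterate_append]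
    rfl

theorem pow_iterate (k n : ℕ) : (σ.pow k).onWord^[n] = σ.onWord^[k * n] := by
  rw [onWord_pow, Function.iterate_mul]

/-- Letters of `σ(x)` may be read in the image of any window that is long enough, not only in the
one fixed by the definition. -/
theorem onBiWord_natCast {x : ℤ → A} {n m : ℕ} (h : m < (σ.onWord (window x 0 n)).length) :
    σ.onBiWord x m = (σ.onWord (window x 0 n))[m] := by
  have h' : m < (σ.onWord (window x 0 (m + 1))).length :=
    lt_of_lt_of_le (by simp [length_window]) (σ.length_le_onWord _)
  change (σ.onWord (window x 0 (m + 1)))[m] = _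
  obtain hn | hn := le_total n (m + 1)
  · obtain ⟨k, hk⟩ := Nat.exists_eq_add_of_le hn
    simp only [hk, window_add, onWord_append]
    rw [List.getElem_append_left h]
  · obtain ⟨k, rfl⟩ := Nat.exists_eq_add_of_le hn
    simp only [window_add x 0 (m + 1), onWord_append]
    rw [List.getElem_append_left h']

theorem onBiWord_negSucc {x : ℤ → A} {n m : ℕ}
    (h : m < (σ.onWord (window x (-n) n)).reverse.length) :
    σ.onBiWord x (Int.negSucc m) = (σ.onWord (window x (-n) n)).reverse[m] := by
  have h' : m < (σ.onWord (window x (Int.negSucc m) (m + 1))).reverse.length := by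
    rw [List.length_reverse]
    exact lt_of_lt_of_le (by simp [length_window]) (σ.length_le_onWord _)
  change (σ.onWord (window x (Int.negSucc m) (m + 1))).reverse[m] = _
  obtain hn | hn := le_total n (m + 1)
  · obtain ⟨k, hk⟩ := Nat.exists_eq_add_of_le' hn
    have e : window x (Int.negSucc m) (m + 1) = window x (Int.negSucc m) k ++ window x (-n) n := by
      rw [hk, window_add]
      congr 2
      omega
    simp only [e, onWord_append, List.reverse_append]
    rw [List.getElem_append_left h]
  · obtain ⟨k, rfl⟩ := Nat.exists_eq_add_of_le' hn
    have e : window x (-((k + (m + 1) : ℕ) : ℤ)) (k + (m + 1)) =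
        window x (-((k + (m + 1) : ℕ) : ℤ)) k ++ window x (Int.negSucc m) (m + 1) := by
      rw [window_add]
      congr 2
      push_cast
      omega
    simp only [e, onWord_append, List.reverse_append]
    rw [List.getElem_append_left h']

theorem window_onBiWord (x : ℤ → A) (m n : ℕ) :
    window (σ.onBiWord x) (-(σ.onWord (window x (-m) m)).length)
      (σ.onWord (window x (-m) (m + n))).length = σ.onWord (window x (-m) (m + n)) := by
  rw [window_add, onWord_append, List.length_append, window_add]
  simp only [neg_add_cancel]
  congr 1
  · refine window_eq_of_getElem fun j hj => ?_
    have h : (σ.onWord (window x (-m) m)).length - 1 - j <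
        (σ.onWord (window x (-m) m)).reverse.length := by
      rw [List.length_reverse]
      omega
    have := σ.onBiWord_negSucc h
    rw [List.getElem_reverse] at this
    convert this using 2
    · omega
    · omega
  · refine window_eq_of_getElem fun j hj => ?_
    rw [zero_add]
    exact σ.onBiWord_natCast hj

variable {σ}

theorem isFactor_onWord_onBiWord {u : List A} {x : ℤ → A} (h : IsFactor u x) :
    IsFactor (σ.onWord u) (σ.onBiWord x) := by
  obtain ⟨N, hN⟩ := h.eventually_infix.exists
  refine IsFactor.of_infix ?_ (σ.onWord_infix hN)
  exact ⟨_, _, (σ.window_onBiWord x N N).symm⟩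

theorem exists_isFactor_of_onBiWord {u : List A} {x : ℤ → A} (h : IsFactor u (σ.onBiWord x)) :
    ∃ v, IsFactor v x ∧ u <:+: σ.onWord v := by
  obtain ⟨N, hN⟩ := h.eventually_infix.exists
  refine ⟨_, isFactor_window x (-N) (N + N), hN.trans ?_⟩
  rw [← σ.window_onBiWord x N N]
  have h₁ := σ.length_le_onWord (window x (-N) N)
  have h₂ := σ.length_le_onWord (window x (-N + N) N)
  rw [length_window] at h₁ h₂
  have h₃ : (σ.onWord (window x (-N) (N + N))).length =
      (σ.onWord (window x (-N) N)).length + (σ.onWord (window x (-N + N) N)).length := by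
    rw [window_add, onWord_append, List.length_append]
  exact window_infix_window _ (by omega) (by omega)

theorem mem_lang_tilde {X : Set (ℤ → A)} {u : List A} :
    u ∈ lang (σ.tilde X) ↔ ∃ v ∈ lang X, u <:+: σ.onWord v := by
  constructor
  · rintro ⟨_, ⟨x, hx, k, rfl⟩, hu⟩
    obtain ⟨v, hv, h⟩ := exists_isFactor_of_onBiWord (isFactor_shift.1 hu)
    exact ⟨v, ⟨x, hx, hv⟩, h⟩
  · rintro ⟨v, ⟨x, hx, hv⟩, h⟩
    exact ⟨_, ⟨x, hx, 0, rfl⟩, isFactor_shift.2 ((isFactor_onWord_onBiWord hv).of_infix h)⟩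

theorem mem_lang_iterate_tilde {X : Set (ℤ → A)} {n : ℕ} {u : List A} :
    u ∈ lang (σ.tilde^[n] X) ↔ ∃ v ∈ lang X, u <:+: σ.onWord^[n] v := by
  induction n generalizing u with
  | zero => exact ⟨fun h => ⟨u, h, List.infix_rfl⟩, fun ⟨v, hv, h⟩ => lang_of_infix hv h⟩
  | succ n ih =>
    rw [Function.iterate_succ_apply', mem_lang_tilde]
    simp only [Function.iterate_succ_apply']
    constructor
    · rintro ⟨w, hw, h⟩
      obtain ⟨v, hv, h'⟩ := ih.1 hw
      exact ⟨v, hv, h.trans (σ.onWord_infix h')⟩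
    · rintro ⟨v, hv, h⟩
      exact ⟨_, ih.2 ⟨v, hv, List.infix_rfl⟩, h⟩

end Substitution

/-! ### Desubstitution of bi-infinite words by compactness. -/

namespace BiWord

variable {A : Type*}

theorem eq_window_of_append_eq {y : ℤ → A} {j : ℤ} {n : ℕ} {p s P W R : List A}
    (h : p ++ window y j n ++ s = P ++ W ++ R) (hP : p.length ≤ P.length)
    (hR : s.length ≤ R.length) : W = window y (j + P.length - p.length) W.length := by
  obtain ⟨P, rfl⟩ : p <+: P :=
    List.prefix_of_prefix_length_le (l₃ := p ++ window y j n ++ s) ⟨window y j n ++ s, by simp⟩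
      ⟨W ++ R, by simp [h]⟩ hP
  obtain ⟨R, rfl⟩ : s <:+ R :=
    List.suffix_of_suffix_length_le (l₃ := p ++ window y j n ++ s) ⟨_, rfl⟩ ⟨_, h.symm⟩ hR
  have h' : window y j n = P ++ W ++ R := by
    have h₁ : p ++ (window y j n ++ s) = p ++ ((P ++ W ++ R) ++ s) := by
      simpa only [List.append_assoc] using h
    exact List.append_cancel_right (List.append_cancel_left h₁)
  obtain rfl : P.length + W.length + R.length = n := by
    simpa [length_window, add_assoc] using (congrArg List.length h').symm
  rw [window_add, window_add] at h'
  have h₁ := (List.append_inj h' (by simp [length_window])).1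
  refine (List.append_inj h₁ (by simp [length_window])).2.symm.trans ?_
  congr 1
  simp
  ring

end BiWord

namespace Substitution

open BiWord

variable {A : Type*} (σ : Substitution A)

theorem exists_split_of_lt_length {v : List A} {q : ℕ} (h : q < (σ.onWord v).length) :
    ∃ v₁ a v₂, v = v₁ ++ a :: v₂ ∧ (σ.onWord v₁).length ≤ q ∧
      q < (σ.onWord v₁).length + (σ.letter a).length := by
  induction v generalizing q with
  | nil => simp [onWord] at h
  | cons b v ih =>
    by_cases hq : q < (σ.letter b).length
    · exact ⟨[], b, v, rfl, by simp [onWord], by simpa [onWord] using hq⟩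
    · have e (w : List A) : (σ.onWord (b :: w)).length =
          (σ.letter b).length + (σ.onWord w).length := by simp [onWord]
      rw [e] at h
      obtain ⟨v₁, a, v₂, rfl, h₁, h₂⟩ := ih (q := q - (σ.letter b).length) (by omega)
      exact ⟨b :: v₁, a, v₂, rfl, by rw [e]; omega, by rw [e]; omega⟩

theorem length_onWord_le {K : ℕ} (hK : ∀ a, (σ.letter a).length ≤ K) (u : List A) :
    (σ.onWord u).length ≤ K * u.length := by
  induction u with
  | nil => simp [onWord]
  | cons a u ih =>
    have e : (σ.onWord (a :: u)).length = (σ.letter a).length + (σ.onWord u).length := by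
      simp [onWord]
    rw [e, List.length_cons, mul_add, mul_one]
    have := hK a
    omega

theorem exists_length_letter_le [Finite A] : ∃ K, 1 ≤ K ∧ ∀ a, (σ.letter a).length ≤ K := by
  obtain ⟨K, hK⟩ := (Set.finite_range fun a => (σ.letter a).length).bddAbove
  exact ⟨K + 1, by omega, fun a => (hK ⟨a, rfl⟩).trans (by omega)⟩

/-- On the window `[-m, n)`, the word `x` is in `L` and its image is read in `y` with delay
`k`. -/
def LocallyDesubstitutes (L : Set (List A)) (y x : ℤ → A) (k : ℤ) (m n : ℕ) : Prop :=
  window x (-m) (m + n) ∈ L ∧ σ.onWord (window x (-m) (m + n)) =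
    window y (-(σ.onWord (window x (-m) m)).length - k) (σ.onWord (window x (-m) (m + n))).length

variable {σ}

theorem LocallyDesubstitutes.mono {L : Set (List A)}
    (hL : ∀ u v, v ∈ L → u <:+: v → u ∈ L) {y x : ℤ → A} {k : ℤ} {m n m' n' : ℕ}
    (h : σ.LocallyDesubstitutes L y x k m n) (hm : m' ≤ m) (hn : n' ≤ n) :
    σ.LocallyDesubstitutes L y x k m' n' := by
  obtain ⟨i, rfl⟩ := Nat.exists_eq_add_of_le' hm
  obtain ⟨j, rfl⟩ := Nat.exists_eq_add_of_le hn
  obtain ⟨h₁, h₂⟩ := h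
  have e : (-((i + m' : ℕ) : ℤ)) + i = -m' := by push_cast; ring
  have e₁ : window x (-((i + m' : ℕ) : ℤ)) (i + m') =
      window x (-((i + m' : ℕ) : ℤ)) i ++ window x (-m') m' := by
    rw [window_add, e]
  have e₂ : window x (-((i + m' : ℕ) : ℤ)) (i + m' + (n' + j)) =
      window x (-((i + m' : ℕ) : ℤ)) i ++ window x (-m') (m' + n') ++ window x n' j := by
    rw [show i + m' + (n' + j) = i + (m' + n') + j by ring, window_add, window_add, e]
    congr 2
    push_cast
    ring
  refine ⟨hL _ _ h₁ ⟨_, _, e₂.symm⟩, ?_⟩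
  rw [e₁] at h₂
  generalize (σ.onWord (window x (-((i + m' : ℕ) : ℤ)) (i + m' + (n' + j)))).length = N at h₂
  rw [e₂, onWord_append, onWord_append, onWord_append] at h₂
  have := eq_window_of_append_eq (p := []) (s := []) (by simpa using h₂.symm) (by simp) (by simp)
  refine this.trans ?_
  congr 1
  simp only [List.length_nil]
  push_cast
  ring

theorem exists_locallyDesubstitutes {K : ℕ} (hK : 1 ≤ K ∧ ∀ a, (σ.letter a).length ≤ K)
    {L : Set (List A)} (hL : ∀ u v, v ∈ L → u <:+: v → u ∈ L) {y : ℤ → A}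
    (hy : ∀ u, IsFactor u y → ∃ v ∈ L, u <:+: σ.onWord v) (n : ℕ) :
    ∃ (x : ℤ → A) (k : Fin K), σ.LocallyDesubstitutes L y x k n n := by
  -- Images of letters have length at most `K`, so this radius leaves room for `n` whole letter
  -- images on each side of the one covering `y 0`.
  set M := K * (n + 1) with hM
  rw [mul_add, mul_one] at hM
  obtain ⟨v, hv, p, s', e⟩ := hy _ (isFactor_window y (-M) (M + (M + 1)))
  have hlen := congrArg List.length e
  simp only [List.length_append, length_window] at hlen
  obtain ⟨v₁, a, v₂, rfl, h₁, h₂⟩ := σ.exists_split_of_lt_length (v := v) (q := p.length + M)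
    (by omega)
  have ha := hK.2 a
  rw [onWord_append, List.length_append] at hlen
  have hn₁ : n ≤ v₁.length := by
    have := σ.length_onWord_le hK.2 v₁
    by_contra hlt
    have : K * (v₁.length) ≤ K * n := Nat.mul_le_mul_left _ (by omega)
    omega
  have hn₂ : n ≤ (a :: v₂).length := by
    have := σ.length_onWord_le hK.2 (a :: v₂)
    by_contra hlt
    have : K * (a :: v₂).length ≤ K * n := Nat.mul_le_mul_left _ (by omega)
    omega
  obtain ⟨l, s, rfl, hs⟩ : ∃ l s, v₁ = l ++ s ∧ s.length = n :=
    ⟨v₁.take (v₁.length - n), v₁.drop (v₁.length - n), by simp, by simp; omega⟩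
  obtain ⟨t, r, htr, ht⟩ : ∃ t r, a :: v₂ = t ++ r ∧ t.length = n :=
    ⟨(a :: v₂).take n, (a :: v₂).drop n, (List.take_append_drop _ _).symm, by
      rw [List.length_take]; omega⟩
  rw [htr] at hv e hlen
  have hs' := σ.length_onWord_le hK.2 s
  have ht' := σ.length_onWord_le hK.2 t
  rw [hs] at hs'
  rw [ht] at ht'
  simp only [onWord_append, List.length_append] at h₁ h₂ hlen
  have hW := eq_window_of_append_eq (y := y) (p := p) (s := s') (P := σ.onWord l)
    (W := σ.onWord (s ++ t)) (R := σ.onWord r) (by rw [e]; simp [onWord_append])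
    (by omega) (by omega)
  -- Only `[-n, n)` matters; the default letter `a` outside it is arbitrary.
  let x : ℤ → A := fun i => (s ++ t).getD (n + i).toNat a
  have hx : window x (-n) (n + n) = s ++ t := by
    have := window_eq_of_getElem (x := x) (i := -n) (u := s ++ t) (fun m hm => by
      simp only [x, add_neg_cancel_left, Int.toNat_natCast]
      exact List.getD_eq_getElem _ _ hm)
    rwa [List.length_append, hs, ht] at this
  have hx' : window x (-n) n = s := by
    rw [window_add] at hx
    exact (List.append_inj hx (by simp [length_window, hs])).1
  -- The delay is the position of `y 0` inside the image `σ(a)` that covers it, hence it is less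
  -- than `K`.
  refine ⟨x, ⟨p.length + M - (σ.onWord l).length - (σ.onWord s).length, by omega⟩, ?_, ?_⟩
  · rw [hx]
    exact hL _ _ hv ⟨l, r, by simp⟩
  · rw [hx, hx']
    refine hW.trans ?_
    congr 1
    simp only
    omega

/-- Local desubstitutions live in the compact space `(ℤ → A) × Fin K`. The condition on `[-n, n)`
depends on finitely many coordinates and is inherited from larger windows, so a cluster point
satisfies it for every `n`. -/
theorem exists_eq_shift_onBiWord [Finite A] [TopologicalSpace A] [DiscreteTopology A]
    {L : Set (List A)} (hL : ∀ u v, v ∈ L → u <:+: v → u ∈ L) {y : ℤ → A}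
    (hy : ∀ u, IsFactor u y → ∃ v ∈ L, u <:+: σ.onWord v) :
    ∃ x : ℤ → A, (∀ u, IsFactor u x → u ∈ L) ∧ ∃ k, y = shift k (σ.onBiWord x) := by
  obtain ⟨K, hK⟩ := σ.exists_length_letter_le
  choose f g hfg using exists_locallyDesubstitutes hK hL hy
  obtain ⟨⟨x, k⟩, -, hxk⟩ := (isCompact_univ (X := (ℤ → A) × Fin K)).exists_mapClusterPt
    (f := Filter.atTop) (u := fun n => (f n, g n)) (by simp)
  have key (n : ℕ) : σ.LocallyDesubstitutes L y x k n n := by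
    have h₁ : ∀ᶠ z : (ℤ → A) × Fin K in nhds (x, k),
        (window z.1 (-n) n = window x (-n) n ∧
          window z.1 (-n) (n + n) = window x (-n) (n + n)) ∧ z.2 = k := by
      have h₀ : ∀ᶠ i in nhds k, i = k := by rw [nhds_discrete]; exact Filter.eventually_pure.2 rfl
      rw [nhds_prod_eq]
      exact ((eventually_window_eq x _ _).and (eventually_window_eq x _ _)).prod_mk h₀
    obtain ⟨m, ⟨⟨h₂, h₃⟩, h₄⟩, hm⟩ := ((hxk.frequently h₁).and_eventually
      (Filter.eventually_ge_atTop n)).exists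
    have := (hfg m).mono hL hm hm
    change g m = k at h₄
    unfold LocallyDesubstitutes at this ⊢
    rwa [h₂, h₃, h₄] at this
  refine ⟨x, fun u hu => ?_, k, ?_⟩
  · obtain ⟨N, hN⟩ := hu.eventually_infix.exists
    exact hL _ _ (key N).1 hN
  · funext t
    set n := (t + k).natAbs + 1 with hn
    have h := (key n).2
    rw [← σ.window_onBiWord x n n] at h
    rw [length_window, window_eq_iff] at h
    have h₁ := σ.length_le_onWord (window x (-n) n)
    have h₂ := σ.length_le_onWord (window x (-n + n) n)
    rw [length_window] at h₁ h₂
    have h₃ : (σ.onWord (window x (-n) (n + n))).length =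
        (σ.onWord (window x (-n) n)).length + (σ.onWord (window x (-n + n) n)).length := by
      rw [window_add, onWord_append, List.length_append]
    have := h (t + k + (σ.onWord (window x (-n) n)).length).toNat (by omega)
    have e : ((t + k + (σ.onWord (window x (-n) n)).length).toNat : ℤ) =
        t + k + (σ.onWord (window x (-n) n)).length := by omega
    rw [e] at this
    rw [shift]
    convert this.symm using 2 <;> ring

/-! ### Stability and surjectivity of `σ̃` on the subshifts of `X_σ`. -/

theorem isSubshift_tilde [Finite A] [TopologicalSpace A] [DiscreteTopology A]
    {X : Set (ℤ → A)} (hX : IsSubshift X) : IsSubshift (σ.tilde X) := by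
  refine isSubshift_of_shift_mem ?_ (isClosed_of_closure_subset fun y hy => ?_) ?_
  · obtain ⟨x, hx⟩ := hX.1
    exact ⟨_, x, hx, 0, rfl⟩
  · obtain ⟨x, hx, k, rfl⟩ := exists_eq_shift_onBiWord (σ := σ) (L := lang X)
      (fun u v hv h => lang_of_infix hv h) (y := y) fun u hu => by
        rw [← mem_lang_tilde, ← lang_closure]
        exact ⟨y, hy, hu⟩
    exact ⟨x, hX.mem_of_isFactor hx, k, rfl⟩
  · rintro _ ⟨x, hx, k, rfl⟩ l
    exact ⟨x, hx, l + k, shift_shift _ _ _⟩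

theorem language_of_infix {u v : List A} (hv : v ∈ σ.language) (h : u <:+: v) :
    u ∈ σ.language := by
  obtain ⟨a, n, hv⟩ := hv
  exact ⟨a, n, h.trans hv⟩

theorem tilde_subset_subshift {X : Set (ℤ → A)} (hX : X ⊆ σ.subshift) :
    σ.tilde X ⊆ σ.subshift := by
  intro y hy u hu
  obtain ⟨v, ⟨x, hx, hv⟩, h⟩ := mem_lang_tilde.1 (⟨y, hy, hu⟩ : u ∈ lang (σ.tilde X))
  obtain ⟨a, n, hv⟩ := hX hx v hv
  exact ⟨a, n + 1, h.trans (by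
    rw [Function.iterate_succ_apply']
    exact σ.onWord_infix hv)⟩

theorem iterate_tilde_subset_subshift {X : Set (ℤ → A)} (hX : X ⊆ σ.subshift) (n : ℕ) :
    σ.tilde^[n] X ⊆ σ.subshift := by
  induction n with
  | zero => exact hX
  | succ n ih =>
    rw [Function.iterate_succ_apply']
    exact tilde_subset_subshift ih

theorem exists_tilde_eq [Finite A] [TopologicalSpace A] [DiscreteTopology A]
    {X : Set (ℤ → A)} (hX : IsSubshift X) (h : X ⊆ σ.subshift) :
    ∃ Y, IsSubshift Y ∧ Y ⊆ σ.subshift ∧ σ.tilde Y = X := by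
  -- The largest candidate for a preimage: the points of `X_σ` whose factors all have images in
  -- `lang X`.
  let Y : Set (ℤ → A) := {x | ∀ u, IsFactor u x → u ∈ {v | v ∈ σ.language ∧ σ.onWord v ∈ lang X}}
  have hXY : X ⊆ σ.tilde Y := by
    intro y hy
    obtain ⟨x, hx, k, rfl⟩ := exists_eq_shift_onBiWord (σ := σ) (L := σ.language)
      (fun u v hv h => language_of_infix hv h) (y := y) fun u hu => by
        obtain ⟨i, n, rfl⟩ := hu
        -- Length at least 2 excludes `m = 0`, so one application of `σ` can be peeled off.
        obtain ⟨a, m, hm⟩ := h hy _ (isFactor_window y i (n + 2))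
        obtain _ | m := m
        · have := hm.length_le
          simp [length_window] at this
        · rw [Function.iterate_succ_apply'] at hm
          exact ⟨_, ⟨a, m, List.infix_rfl⟩,
            (window_infix_window y le_rfl (by push_cast; omega)).trans hm⟩
    refine ⟨x, fun u hu => ⟨hx u hu, _, hy, ?_⟩, k, rfl⟩
    exact isFactor_shift.2 (isFactor_onWord_onBiWord hu)
  have hYs : IsSubshift Y := by
    refine isSubshift_of_shift_mem ?_ (isClosed_setOf_isFactor _) fun x hx k u hu =>
      hx u (isFactor_shift.1 hu)
    obtain ⟨y, hy⟩ := hX.1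
    obtain ⟨x, hx, -⟩ := hXY hy
    exact ⟨x, hx⟩
  refine ⟨Y, hYs, fun x hx u hu => (hx u hu).1, Set.Subset.antisymm ?_ hXY⟩
  refine hX.subset_of_lang_subset fun u hu => ?_
  obtain ⟨v, ⟨x, hx, hv⟩, huv⟩ := mem_lang_tilde.1 hu
  exact lang_of_infix (hx v hv).2 huv

theorem isSubshift_iterate_tilde [Finite A] [TopologicalSpace A] [DiscreteTopology A]
    {X : Set (ℤ → A)} (hX : IsSubshift X) (n : ℕ) :
    IsSubshift (σ.tilde^[n] X) := by
  induction n with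
  | zero => exact hX
  | succ n ih =>
    rw [Function.iterate_succ_apply']
    exact isSubshift_tilde ih

theorem exists_iterate_tilde_eq [Finite A] [TopologicalSpace A] [DiscreteTopology A]
    {X : Set (ℤ → A)} (hX : IsSubshift X) (h : X ⊆ σ.subshift)
    (n : ℕ) : ∃ Y, IsSubshift Y ∧ Y ⊆ σ.subshift ∧ σ.tilde^[n] Y = X := by
  induction n with
  | zero => exact ⟨X, hX, h, rfl⟩
  | succ n ih =>
    obtain ⟨Z, hZ, hZ', rfl⟩ := ih
    obtain ⟨Y, hY, hY', rfl⟩ := exists_tilde_eq hZ hZ'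
    exact ⟨Y, hY, hY', Function.iterate_succ_apply _ _ _⟩

end Substitution

/-- The iterates of `f` are ultimately periodic; `n` is a multiple of the period that is past the
preperiod. -/
theorem Function.exists_iterate_mul_eq {α : Type*} [Finite α] (f : α → α) :
    ∃ n, 1 ≤ n ∧ ∀ q, 1 ≤ q → f^[n * q] = f^[n] := by
  obtain ⟨i, j, hij, e⟩ : ∃ i j, i < j ∧ f^[i] = f^[j] := by
    obtain ⟨i, j, hne, e⟩ := Finite.exists_ne_map_eq_of_infinite fun n => f^[n]
    obtain h | h := lt_or_gt_of_ne hne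
    exacts [⟨i, j, h, e⟩, ⟨j, i, h, e.symm⟩]
  obtain ⟨d, rfl⟩ := Nat.exists_eq_add_of_lt hij
  have h₁ (m : ℕ) (hm : i ≤ m) : f^[(d + 1) + m] = f^[m] := by
    obtain ⟨l, rfl⟩ := Nat.exists_eq_add_of_le hm
    rw [← add_assoc, Function.iterate_add, add_comm (d + 1) i, ← add_assoc, ← e,
      ← Function.iterate_add]
  have h₂ (q m : ℕ) (hm : i ≤ m) : f^[q * (d + 1) + m] = f^[m] := by
    induction q with
    | zero => simp
    | succ q ih => rw [add_mul, one_mul, add_comm (q * (d + 1)), add_assoc, h₁ _ (by omega), ih]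
  refine ⟨(i + 1) * (d + 1), Nat.mul_pos (by omega) (by omega), fun q hq => ?_⟩
  obtain ⟨q, rfl⟩ := Nat.exists_eq_add_of_le' hq
  rw [show (i + 1) * (d + 1) * (q + 1) = q * (i + 1) * (d + 1) + (i + 1) * (d + 1) by ring,
    h₂ _ _ (by nlinarith)]

/-! ### Factors of images under two maps that agree at both ends. -/

namespace List

variable {A B : Type*}

theorem IsPrefix.of_take_eq {l : ℕ} {p x y : List A} (h : p <+: x)
    (hp : p.length ≤ l) (hxy : x.take (l + 1) = y.take (l + 1)) : p <+: y := by
  have h₁ : p <+: y.take (l + 1) := by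
    rw [← hxy, prefix_take_iff]
    exact ⟨h, by omega⟩
  exact h₁.trans (take_prefix _ _)

/-- This is why truncation is at `l + 1` rather than `l`: the extra letter shows whether a word has
length at most `l`. -/
theorem eq_of_take_eq {l : ℕ} {x y : List A} (hx : x.length ≤ l)
    (hxy : x.take (l + 1) = y.take (l + 1)) : x = y := by
  have h := congrArg length hxy
  rw [length_take, length_take] at h
  rwa [take_of_length_le (by omega), take_of_length_le (by omega)] at hxy

theorem IsPrefix.flatMap_of_take_eq {l : ℕ} {α β : A → List B}
    (h : ∀ a, (α a).take (l + 1) = (β a).take (l + 1)) {p : List B} {v : List A}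
    (hp : p <+: v.flatMap α) (hl : p.length ≤ l) : p <+: v.flatMap β := by
  induction v generalizing p with
  | nil => simpa using hp
  | cons a v ih =>
    rw [flatMap_cons] at hp ⊢
    obtain hlt | hle := le_total p.length (α a).length
    · have := prefix_of_prefix_length_le hp (prefix_append _ _) hlt
      exact (this.of_take_eq hl (h a)).trans (prefix_append _ _)
    · obtain ⟨q, rfl⟩ := prefix_of_prefix_length_le (prefix_append _ _) hp hle
      rw [length_append] at hl
      rw [prefix_append_right_inj] at hp
      rw [← eq_of_take_eq (by omega) (h a), prefix_append_right_inj]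
      exact ih hp (by omega)

theorem IsSuffix.of_take_reverse_eq {l : ℕ} {p x y : List A} (h : p <:+ x)
    (hp : p.length ≤ l) (hxy : x.reverse.take (l + 1) = y.reverse.take (l + 1)) : p <:+ y := by
  rw [← reverse_prefix] at h ⊢
  exact h.of_take_eq (by simpa) hxy

/-- If `α` and `β` agree up to length `l + 1` at both ends of the images of letters, then every
factor of length at most `l` of the image by `α` of a word is a factor of the image by `α` of one
of its letters or of the image by `β` of the word. -/
theorem IsInfix.flatMap_of_take_eq {l : ℕ} {α β : A → List B}
    (h : ∀ a, (α a).take (l + 1) = (β a).take (l + 1))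
    (h' : ∀ a, (α a).reverse.take (l + 1) = (β a).reverse.take (l + 1)) {u : List B}
    {v : List A} (hu : u <:+: v.flatMap α) (hl : u.length ≤ l) :
    (∃ a ∈ v, u <:+: α a) ∨ u <:+: v.flatMap β := by
  induction v with
  | nil => exact Or.inr (by simpa using hu)
  | cons a v ih =>
    rw [flatMap_cons, infix_append_iff] at hu
    obtain hu | hu | ⟨s, p, rfl, hs, hp⟩ := hu
    · exact Or.inl ⟨a, by simp, hu⟩
    · obtain ⟨b, hb, hu⟩ | hu := ih hu
      · exact Or.inl ⟨b, mem_cons_of_mem _ hb, hu⟩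
      · exact Or.inr (hu.trans (by rw [flatMap_cons]; exact infix_append_right))
    · rw [length_append] at hl
      refine Or.inr ?_
      rw [flatMap_cons, infix_append_iff]
      exact Or.inr (Or.inr ⟨s, p, rfl, hs.of_take_reverse_eq (by omega) (h' a),
        hp.flatMap_of_take_eq h (by omega)⟩)

theorem take_append_congr {l : ℕ} {x x' y y' : List A} (hx : x ≠ [])
    (h : x.take (l + 1) = x'.take (l + 1)) (hy : y.take l = y'.take l) :
    (x ++ y).take (l + 1) = (x' ++ y').take (l + 1) := by
  obtain hle | hlt := le_or_gt x.length l
  · obtain rfl := eq_of_take_eq hle h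
    have := length_pos_iff.2 hx
    have e : y.take (l + 1 - x.length) = y'.take (l + 1 - x.length) := by
      have := congrArg (take (l + 1 - x.length)) hy
      rwa [take_take, take_take, min_eq_left (by omega)] at this
    rw [take_append, take_append, e]
  · have h₁ := congrArg length h
    rw [length_take, length_take] at h₁
    rw [take_append_of_le_length (by omega), take_append_of_le_length (by omega), h]

end List

/-! ### Stabilisation of the ends of iterated images. -/

namespace Substitution

open BiWord Filter

variable {A : Type*} (σ : Substitution A)

theorem iterate_ne_nil (n : ℕ) {u : List A} (hu : u ≠ []) : σ.onWord^[n] u ≠ [] := by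
  have := σ.length_le_iterate n u
  have := List.length_pos_iff.2 hu
  exact List.length_pos_iff.1 (by omega)

/-- The first letter of the image of a letter. -/
def headLetter (a : A) : A := (σ.letter a).head (σ.nonerasing a)

theorem exists_iterate_eq_cons (n : ℕ) (a : A) :
    ∃ u, σ.onWord^[n] [a] = σ.headLetter^[n] a :: u := by
  induction n with
  | zero => exact ⟨[], rfl⟩
  | succ n ih =>
    obtain ⟨u, hu⟩ := ih
    simp only [Function.iterate_succ_apply', hu]
    refine ⟨(σ.letter (σ.headLetter^[n] a)).tail ++ σ.onWord u, ?_⟩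
    rw [← List.cons_append, headLetter, List.cons_head_tail]
    rfl

variable {σ}

/-- Either the lengths reach `l`, or they are bounded and the chain is ultimately constant. -/
theorem eventually_take_eq_of_prefix {f : ℕ → List A} (h : ∀ n, f n <+: f (n + 1)) (l : ℕ) :
    ∀ᶠ n in atTop, (f n).take l = (f (n + 1)).take l := by
  have hmono : Monotone fun n => (f n).length := monotone_nat_of_le_succ fun n => (h n).length_le
  by_cases hb : ∃ N, l ≤ (f N).length
  · obtain ⟨N, hN⟩ := hb
    filter_upwards [eventually_ge_atTop N] with n hn
    obtain ⟨t, ht⟩ := h n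
    rw [← ht, List.take_append_of_le_length (hN.trans (hmono hn))]
  · push Not at hb
    obtain ⟨N, hN⟩ : ∃ N, ∀ n, (f n).length ≤ (f N).length := by
      obtain ⟨_, ⟨N, rfl⟩, hN⟩ := (Set.range fun n => (f n).length).exists_max_image id
        ((Set.finite_lt_nat l).subset (by rintro _ ⟨n, rfl⟩; exact hb n)) (Set.range_nonempty _)
      exact ⟨N, fun n => hN _ ⟨n, rfl⟩⟩
    filter_upwards [eventually_ge_atTop N] with n hn
    rw [(h n).eq_of_length_le ((hN _).trans (hmono hn))]

/-- If the first-letter map is idempotent, the beginning of given length of the iterated images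
of a word is ultimately constant. -/
theorem eventually_take_eq (hσ : ∀ a, σ.headLetter (σ.headLetter a) = σ.headLetter a) (l : ℕ)
    (v : List A) : ∀ᶠ n in atTop, (σ.onWord^[n] v).take l = (σ.onWord^[n + 1] v).take l := by
  induction l generalizing v with
  | zero => simp
  | succ l ih =>
    obtain _ | ⟨a, v⟩ := v
    · simp [iterate_nil]
    obtain ⟨u, hu⟩ := σ.exists_iterate_eq_cons 1 a
    obtain ⟨w, hw⟩ := σ.exists_iterate_eq_cons 1 (σ.headLetter a)
    simp only [Function.iterate_one, hσ] at hu hw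
    set b := σ.headLetter a
    have e : σ.onWord (a :: v) = [b] ++ (u ++ σ.onWord v) := by
      rw [← List.singleton_append, onWord_append, hu]
      simp
    have h₁ : ∀ᶠ n in atTop, (σ.onWord^[n] [b]).take (l + 1) =
        (σ.onWord^[n + 1] [b]).take (l + 1) := by
      refine eventually_take_eq_of_prefix (fun n => ?_) _
      rw [Function.iterate_succ_apply, hw, ← List.singleton_append (l := w), iterate_append]
      exact List.prefix_append _ _
    -- Since `σ(b)` starts with `b`, the words `σ^n(b)` form a prefix chain. They are non-empty, so
    -- for the rest of the word only `l` letters are needed, as the induction provides.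
    obtain ⟨N, hN⟩ := eventually_atTop.1 (h₁.and (ih (u ++ σ.onWord v)))
    filter_upwards [eventually_ge_atTop (N + 1)] with n hn
    obtain ⟨n, rfl⟩ := Nat.exists_eq_add_of_le' (show 1 ≤ n by omega)
    obtain ⟨h₁, h₂⟩ := hN n (by omega)
    rw [Function.iterate_succ_apply, Function.iterate_succ_apply _ (n + 1), e, iterate_append,
      iterate_append _ (n + 1)]
    exact List.take_append_congr (σ.iterate_ne_nil n (by simp)) h₁ h₂

variable (σ) in
/-- The mirror image of a substitution. -/
def mirror : Substitution A where
  letter a := (σ.letter a).reverse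
  nonerasing a := by simpa using σ.nonerasing a

theorem onWord_mirror (u : List A) : σ.mirror.onWord u = (σ.onWord u.reverse).reverse := by
  simp [onWord, mirror, List.reverse_flatMap, Function.comp_def]

theorem iterate_mirror (n : ℕ) (u : List A) :
    σ.mirror.onWord^[n] u = (σ.onWord^[n] u.reverse).reverse := by
  induction n with
  | zero => simp
  | succ n ih => rw [Function.iterate_succ_apply', ih, onWord_mirror, List.reverse_reverse,
      Function.iterate_succ_apply']

theorem mirror_pow (n : ℕ) : (σ.pow n).mirror = σ.mirror.pow n := by
  have h : (σ.pow n).mirror.letter = (σ.mirror.pow n).letter :=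
    funext fun a => (iterate_mirror n [a]).symm
  cases h' : (σ.pow n).mirror
  cases h'' : σ.mirror.pow n
  simpa [h', h''] using h

theorem headLetter_pow (n : ℕ) (a : A) : (σ.pow n).headLetter a = σ.headLetter^[n] a := by
  obtain ⟨u, hu⟩ := σ.exists_iterate_eq_cons n a
  simp [headLetter, pow, hu]

/-- The factors of length `l` of the images of words in `S`. -/
def factorsOnWord (σ : Substitution A) (l : ℕ) (S : Set {u : List A // u.length = l}) :
    Set {u : List A // u.length = l} :=
  {u | ∃ v ∈ S, u.1 <:+: σ.onWord v.1}

/-- The words of length `l` of the language of `X`. -/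
def langOfLength (X : Set (ℤ → A)) (l : ℕ) : Set {u : List A // u.length = l} :=
  {u | u.1 ∈ lang X}

end Substitution

/-! ### Languages of fixed length and the uniform period of `σ̃`. -/

namespace Substitution

open BiWord Filter

variable {A : Type*} {σ : Substitution A}

theorem prefix_onWord_take {p v : List A} (h : p <+: σ.onWord v) :
    p <+: σ.onWord (v.take p.length) := by
  obtain hle | hlt := le_or_gt p.length (σ.onWord (v.take p.length)).length
  · refine List.prefix_of_prefix_length_le h ⟨σ.onWord (v.drop p.length), ?_⟩ hle
    rw [← onWord_append, List.take_append_drop]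
  · have := (σ.length_le_onWord _).trans_lt hlt
    rw [List.length_take] at this
    rwa [List.take_of_length_le (by omega)]

/-- As `σ` is non-erasing, each letter needed to cover `u` can be charged to a different letter of
`u`. -/
theorem exists_infix_of_infix_onWord {u v : List A} (h : u <:+: σ.onWord v) :
    ∃ w, w <:+: v ∧ w.length ≤ u.length ∧ u <:+: σ.onWord w := by
  obtain rfl | hu := eq_or_ne u []
  · exact ⟨[], List.nil_infix, le_rfl, List.nil_infix⟩
  have hpos := List.length_pos_iff.2 hu
  induction v with
  | nil => exact absurd (by simpa [onWord] using h) hu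
  | cons a v ih =>
    have e (w : List A) : σ.onWord (a :: w) = σ.letter a ++ σ.onWord w := by simp [onWord]
    have ih' (h : u <:+: σ.onWord v) :
        ∃ w, w <:+: a :: v ∧ w.length ≤ u.length ∧ u <:+: σ.onWord w := by
      obtain ⟨w, hw, h₁, h₂⟩ := ih h
      exact ⟨w, hw.trans (List.suffix_cons a v).isInfix, h₁, h₂⟩
    rw [e, List.infix_append_iff] at h
    obtain h | h | ⟨s, p, rfl, hs, hp⟩ := h
    · exact ⟨[a], ⟨[], v, rfl⟩, hpos, by rwa [onWord_singleton]⟩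
    · exact ih' h
    · obtain rfl | hs' := eq_or_ne s []
      · exact ih' hp.isInfix
      · refine ⟨a :: v.take p.length, ⟨[], v.drop p.length, by simp⟩, ?_, ?_⟩
        · have := List.length_pos_iff.2 hs'
          simp only [List.length_cons, List.length_take, List.length_append]
          omega
        · rw [e, List.infix_append_iff]
          exact Or.inr (Or.inr ⟨s, p, rfl, hs, prefix_onWord_take hp⟩)

theorem langOfLength_tilde (X : Set (ℤ → A)) (l : ℕ) :
    langOfLength (σ.tilde X) l = σ.factorsOnWord l (langOfLength X l) := by
  ext ⟨u, rfl⟩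
  constructor
  · intro hu
    obtain ⟨v, ⟨x, hx, hv⟩, h⟩ := mem_lang_tilde.1 hu
    obtain ⟨w, hw, hl, h⟩ := exists_infix_of_infix_onWord h
    obtain ⟨i, n, rfl⟩ := hv.of_infix hw
    rw [length_window] at hl
    change n ≤ u.length at hl
    refine ⟨⟨window x i u.length, length_window _ _ _⟩, ⟨x, hx, isFactor_window _ _ _⟩, ?_⟩
    exact h.trans (σ.onWord_infix (window_infix_window x le_rfl (by omega)))
  · rintro ⟨v, hv, h⟩
    exact mem_lang_tilde.2 ⟨v.1, hv, h⟩

theorem langOfLength_iterate_tilde (X : Set (ℤ → A)) (l n : ℕ) :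
    langOfLength (σ.tilde^[n] X) l = (σ.factorsOnWord l)^[n] (langOfLength X l) := by
  induction n with
  | zero => rfl
  | succ n ih => rw [Function.iterate_succ_apply', langOfLength_tilde, ih,
      Function.iterate_succ_apply']

variable [Finite A] [TopologicalSpace A] [DiscreteTopology A]

variable (σ) in
theorem exists_langOfLength_iterate_tilde_eq (l : ℕ) :
    ∃ n, 1 ≤ n ∧ ∀ q, 1 ≤ q → ∀ X, IsSubshift X → X ⊆ σ.subshift →
      langOfLength (σ.tilde^[n * q] X) l = langOfLength X l := by
  have : Finite {u : List A // u.length = l} := List.finite_length_eq A l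
  obtain ⟨n, hn, h⟩ := Function.exists_iterate_mul_eq (σ.factorsOnWord l)
  refine ⟨n, hn, fun q hq X hX hXσ => ?_⟩
  -- Surjectivity puts `X` in the image of `σ̃^n`, where ultimate periodicity becomes periodicity.
  obtain ⟨Y, -, -, rfl⟩ := exists_iterate_tilde_eq hX hXσ n
  rw [← Function.iterate_add_apply, langOfLength_iterate_tilde, langOfLength_iterate_tilde,
    show n * q + n = n * (q + 1) by ring, h _ (by omega)]

variable (σ) in
theorem exists_lang_subset_lang_iterate_tilde :
    ∃ P, 1 ≤ P ∧ ∀ X, IsSubshift X → X ⊆ σ.subshift → lang X ⊆ lang (σ.tilde^[P] X) := by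
  obtain ⟨n₁, hn₁, h₁⟩ := exists_langOfLength_iterate_tilde_eq σ 1
  obtain ⟨n₂, hn₂, h₂⟩ := Function.exists_iterate_mul_eq σ.headLetter
  obtain ⟨n₃, hn₃, h₃⟩ := Function.exists_iterate_mul_eq σ.mirror.headLetter
  have h₁₂ := Nat.mul_pos hn₁ hn₂
  have h₁₃ := Nat.mul_pos hn₁ hn₃
  have h₂₃ := Nat.mul_pos hn₂ hn₃
  obtain ⟨P, hP⟩ : ∃ P, P = n₁ * (n₂ * n₃) := ⟨_, rfl⟩
  have hP₁ : 1 ≤ P := hP ▸ Nat.mul_pos hn₁ h₂₃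
  have e₂ (a : A) : (σ.pow P).headLetter ((σ.pow P).headLetter a) = (σ.pow P).headLetter a := by
    rw [headLetter_pow, headLetter_pow, ← Function.iterate_add_apply,
      show P + P = n₂ * ((n₁ * n₃) * 2) by rw [hP]; ring, h₂ _ (by omega),
      show P = n₂ * (n₁ * n₃) by rw [hP]; ring, h₂ _ h₁₃]
  have e₃ (a : A) : (σ.pow P).mirror.headLetter ((σ.pow P).mirror.headLetter a) =
      (σ.pow P).mirror.headLetter a := by
    rw [mirror_pow, headLetter_pow, headLetter_pow, ← Function.iterate_add_apply,
      show P + P = n₃ * ((n₁ * n₂) * 2) by rw [hP]; ring, h₃ _ (by omega),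
      show P = n₃ * (n₁ * n₂) by rw [hP]; ring, h₃ _ h₁₂]
  refine ⟨P, hP₁, fun X hX hXσ u hu => ?_⟩
  obtain ⟨N, hN₁, hN₂⟩ := ((eventually_all.2 fun a => eventually_take_eq e₂ (u.length + 1) [a]).and
    (eventually_all.2 fun a => eventually_take_eq e₃ (u.length + 1) [a])).exists
  simp only [iterate_mirror, List.reverse_singleton, pow_iterate] at hN₁ hN₂
  obtain ⟨Y, hY, hYσ, rfl⟩ := exists_iterate_tilde_eq hX hXσ (P * N)
  obtain ⟨v, hv, h⟩ := mem_lang_iterate_tilde.1 hu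
  have e (k : ℕ) : σ.onWord^[k] v = v.flatMap fun a => σ.onWord^[k] [a] :=
    congrFun (σ.onWord_pow k).symm v
  rw [e] at h
  obtain ⟨a, ha, h⟩ | h := h.flatMap_of_take_eq hN₁ hN₂ le_rfl
  · rw [← Function.iterate_add_apply, add_comm, Function.iterate_add_apply]
    refine mem_lang_iterate_tilde.2 ⟨[a], ?_, h⟩
    -- `P` is a multiple of `n₁`, so `Y` and `σ̃^P(Y)` have the same letters.
    have ha' : (⟨[a], rfl⟩ : {u : List A // u.length = 1}) ∈ langOfLength Y 1 :=
      lang_of_infix hv (List.singleton_infix_iff _ _ |>.2 ha)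
    rw [← h₁ _ h₂₃ Y hY hYσ, ← hP] at ha'
    exact ha'
  · rw [← Function.iterate_add_apply, show P + P * N = P * (N + 1) by ring]
    exact mem_lang_iterate_tilde.2 ⟨v, hv, by rwa [e]⟩

variable (σ) in
theorem exists_iterate_tilde_eq_self :
    ∃ P, 1 ≤ P ∧ ∀ X, IsSubshift X → X ⊆ σ.subshift → σ.tilde^[P] X = X := by
  obtain ⟨P, hP, h⟩ := exists_lang_subset_lang_iterate_tilde σ
  refine ⟨P, hP, fun X hX hXσ => Set.Subset.antisymm ?_ ?_⟩
  · refine hX.subset_of_lang_subset fun u hu => ?_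
    obtain ⟨n, hn, hn'⟩ := exists_langOfLength_iterate_tilde_eq σ u.length
    -- The increasing chain carries `u` to the exponent `P * n`, where words of its length are those
    -- of `X`.
    have hchain (m : ℕ) : u ∈ lang (σ.tilde^[P * (m + 1)] X) := by
      induction m with
      | zero => simpa using hu
      | succ m ih =>
        have := h _ (isSubshift_iterate_tilde hX _) (iterate_tilde_subset_subshift hXσ _) ih
        rwa [← Function.iterate_add_apply, show P + P * (m + 1) = P * (m + 1 + 1) by ring] at this
    obtain ⟨m, rfl⟩ := Nat.exists_eq_add_of_le' hn
    have hu' : (⟨u, rfl⟩ : {v : List A // v.length = u.length}) ∈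
        langOfLength (σ.tilde^[P * (m + 1)] X) u.length := hchain m
    rw [mul_comm, hn' P hP X hX hXσ] at hu'
    exact hu'
  · exact (isSubshift_iterate_tilde hX P).subset_of_lang_subset (h X hX hXσ)

theorem bijOn_tilde : Set.BijOn σ.tilde {X | IsSubshift X ∧ X ⊆ σ.subshift}
    {X | IsSubshift X ∧ X ⊆ σ.subshift} := by
  obtain ⟨P, hP, h⟩ := exists_iterate_tilde_eq_self σ
  obtain ⟨n, rfl⟩ := Nat.exists_eq_add_of_le' hP
  refine ⟨fun X hX => ⟨isSubshift_tilde hX.1, tilde_subset_subshift hX.2⟩,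
    fun X hX Y hY e => ?_, fun X hX => ?_⟩
  · rw [← h X hX.1 hX.2, ← h Y hY.1 hY.2, Function.iterate_succ_apply, e,
      ← Function.iterate_succ_apply]
  · obtain ⟨Y, hY, hY', e⟩ := exists_tilde_eq hX.1 hX.2
    exact ⟨Y, ⟨hY, hY'⟩, e⟩

end Substitution

/-! ### Growing letters and periodic alphabets. -/

namespace Substitution

open BiWord

variable {A : Type*} {σ : Substitution A}

variable (σ) in
/-- The set of growing letters occurring in the images of the letters of `D`. -/
def alphImage (D : Set A) : Set A := ⋃ a ∈ D, σ.alphWord (σ.letter a)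

theorem exists_length_iterate_le {u : List A} (hu : ∀ a ∈ u, a ∈ σ.boundedLetters) :
    ∃ M, ∀ n, (σ.onWord^[n] u).length ≤ M := by
  induction u with
  | nil => exact ⟨0, fun n => by simp [iterate_nil]⟩
  | cons a u ih =>
    obtain ⟨M₁, h₁⟩ := hu a (by simp)
    obtain ⟨M₂, h₂⟩ := ih fun b hb => hu b (List.mem_cons_of_mem _ hb)
    refine ⟨M₁ + M₂, fun n => ?_⟩
    rw [← List.singleton_append, iterate_append, List.length_append]
    exact add_le_add (h₁ n) (h₂ n)

theorem mem_boundedLetters_of_mem_iterate {a b : A} (ha : a ∈ σ.boundedLetters) {n : ℕ}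
    (hb : b ∈ σ.onWord^[n] [a]) : b ∈ σ.boundedLetters := by
  obtain ⟨M, hM⟩ := ha
  refine ⟨M, fun m => le_trans ?_ (hM (m + n))⟩
  rw [Function.iterate_add_apply]
  exact (σ.iterate_infix m (List.singleton_infix_iff _ _ |>.2 hb)).length_le

theorem mem_growingLetters_of_mem_letter {a b : A} (hb : b ∈ σ.growingLetters)
    (h : b ∈ σ.letter a) : a ∈ σ.growingLetters :=
  fun ha => hb (mem_boundedLetters_of_mem_iterate ha (n := 1) (by simpa [onWord_singleton]))

theorem alphImage_subset (D : Set A) : σ.alphImage D ⊆ σ.growingLetters :=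
  Set.iUnion₂_subset fun _ _ _ h => h.1

/-- A letter whose image contains only bounded letters is itself bounded. -/
theorem alphImage_nonempty {D : Set A} (hD : D ⊆ σ.growingLetters) (h : D.Nonempty) :
    (σ.alphImage D).Nonempty := by
  obtain ⟨a, ha⟩ := h
  by_contra hne
  rw [Set.not_nonempty_iff_eq_empty] at hne
  obtain ⟨M, hM⟩ := exists_length_iterate_le (σ := σ) (u := σ.letter a) fun b hb => by
    by_contra hb'
    have : b ∈ σ.alphImage D := Set.mem_iUnion₂.2 ⟨a, ha, hb', hb⟩
    simp [hne] at this
  refine hD ha ⟨M + 1, fun n => ?_⟩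
  obtain _ | n := n
  · simp
  · rw [Function.iterate_succ_apply, onWord_singleton]
    exact (hM n).trans (by omega)

theorem arrowPow_iff {D D' : Set A} (hD : D ⊆ σ.growingLetters) (h : D.Nonempty) {n : ℕ} :
    σ.ArrowPow n D D' ↔ σ.alphImage^[n] D = D' := by
  induction n generalizing D with
  | zero => rfl
  | succ n ih =>
    rw [Function.iterate_succ_apply, ← ih (alphImage_subset D) (alphImage_nonempty hD h)]
    constructor
    · rintro ⟨E, ⟨-, -, rfl⟩, hE⟩
      exact hE
    · exact fun hE => ⟨_, ⟨hD, h, rfl⟩, hE⟩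

/-- Bounded letters have only bounded descendants, so every ancestor of a growing letter is growing
and none is lost by discarding bounded letters at each step. -/
theorem mem_iterate_alphImage {D : Set A} (hD : D ⊆ σ.growingLetters) {n : ℕ} {b : A} :
    b ∈ σ.alphImage^[n] D ↔ b ∈ σ.growingLetters ∧ ∃ a ∈ D, b ∈ σ.onWord^[n] [a] := by
  induction n generalizing b with
  | zero => exact ⟨fun h => ⟨hD h, b, h, by simp⟩, fun ⟨_, a, ha, hb⟩ => by simp_all⟩
  | succ n ih =>
    simp only [Function.iterate_succ_apply', mem_onWord, alphImage, Set.mem_iUnion₂]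
    constructor
    · rintro ⟨c, hc, hb, hbc⟩
      obtain ⟨-, a, ha, hca⟩ := ih.1 hc
      exact ⟨hb, a, ha, c, hca, hbc⟩
    · rintro ⟨hb, a, ha, c, hca, hbc⟩
      exact ⟨c, ih.2 ⟨mem_growingLetters_of_mem_letter hb hbc, a, ha, hca⟩, hb, hbc⟩

theorem isPeriodicAlphabet_minimalPeriod {D : Set A} (hD : D ⊆ σ.growingLetters)
    (h : D.Nonempty) {k : ℕ} (hk : 1 ≤ k) (hDk : Function.IsPeriodicPt σ.alphImage k D) :
    σ.IsPeriodicAlphabet (Function.minimalPeriod σ.alphImage D) D := by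
  constructor
  · exact ⟨hDk.minimalPeriod_pos hk,
      (arrowPow_iff hD h).2 (Function.isPeriodicPt_minimalPeriod _ _)⟩
  · rintro n ⟨hn, hDn⟩
    exact Function.IsPeriodicPt.minimalPeriod_le hn ((arrowPow_iff hD h).1 hDn)

theorem alphC_subset (X : Set (ℤ → A)) : σ.alphC X ⊆ σ.growingLetters := fun _ h => h.1

theorem alphC_tilde (X : Set (ℤ → A)) : σ.alphC (σ.tilde X) = σ.alphImage (σ.alphC X) := by
  ext c
  simp only [alphImage, Set.mem_iUnion₂]
  constructor
  · rintro ⟨hc, h⟩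
    obtain ⟨v, hv, hcv⟩ := mem_lang_tilde.1 h
    obtain ⟨a, ha, hca⟩ := mem_onWord _ |>.1 (hcv.subset (List.mem_singleton_self c))
    exact ⟨a, ⟨mem_growingLetters_of_mem_letter hc hca,
      lang_of_infix hv (List.singleton_infix_iff _ _ |>.2 ha)⟩, hc, hca⟩
  · rintro ⟨a, ⟨-, ha⟩, hc, hca⟩
    refine ⟨hc, mem_lang_tilde.2 ⟨[a], ha, ?_⟩⟩
    rw [onWord_singleton]
    exact List.singleton_infix_iff _ _ |>.2 hca

theorem alphC_iterate_tilde (X : Set (ℤ → A)) (n : ℕ) :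
    σ.alphC (σ.tilde^[n] X) = σ.alphImage^[n] (σ.alphC X) := by
  induction n with
  | zero => rfl
  | succ n ih => rw [Function.iterate_succ_apply', alphC_tilde, ih, Function.iterate_succ_apply']

theorem preserves_union_boundedLetters {D : Set A} (hD : D ⊆ σ.growingLetters) {n : ℕ}
    (h : Function.IsPeriodicPt σ.alphImage n D) : (σ.pow n).Preserves (D ∪ σ.boundedLetters) := by
  intro a ha b hb
  by_cases hb' : b ∈ σ.boundedLetters
  · exact Or.inr hb'
  · obtain ha | ha := ha
    · left
      rw [← h.eq]
      exact (mem_iterate_alphImage hD).2 ⟨hb', a, ha, hb⟩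
    · exact absurd (mem_boundedLetters_of_mem_iterate ha hb) hb'

theorem map_onWord_restrict {S : Set A} (h : σ.Preserves S) (u : List S) :
    ((σ.restrict S h).onWord u).map Subtype.val = σ.onWord (u.map Subtype.val) := by
  simp [onWord, restrict, List.map_flatMap]

theorem map_iterate_restrict {S : Set A} (h : σ.Preserves S) (n : ℕ) (u : List S) :
    ((σ.restrict S h).onWord^[n] u).map Subtype.val = σ.onWord^[n] (u.map Subtype.val) := by
  induction n generalizing u with
  | zero => rfl
  | succ n ih => rw [Function.iterate_succ_apply, ih, map_onWord_restrict,
      Function.iterate_succ_apply]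

theorem restrictSubshift_subset [Finite A] [TopologicalSpace A]
    {X : Set (ℤ → A)} (hX : IsSubshift X) {k p : ℕ} (hk : 1 ≤ k) (hXk : σ.tilde^[k] X = X)
    (hp : Function.IsPeriodicPt σ.alphImage p (σ.alphC X))
    (h : (σ.pow p).Preserves (σ.alphC X ∪ σ.boundedLetters)) :
    (σ.pow p).restrictSubshift (σ.alphC X ∪ σ.boundedLetters) h ⊆ X := by
  rintro _ ⟨x, hx, rfl⟩
  refine hX.mem_of_isFactor ?_
  rintro _ ⟨i, n, rfl⟩
  have hM : ∃ M, ∀ a ∈ σ.boundedLetters, ∀ n, (σ.onWord^[n] [a]).length ≤ M := by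
    have (a : A) : ∃ M, a ∈ σ.boundedLetters → ∀ n, (σ.onWord^[n] [a]).length ≤ M := by
      by_cases ha : a ∈ σ.boundedLetters
      · obtain ⟨M, hM⟩ := ha
        exact ⟨M, fun _ => hM⟩
      · exact ⟨0, fun h => absurd h ha⟩
    choose f hf using this
    obtain ⟨M, hM⟩ := (Set.finite_range f).bddAbove
    exact ⟨M, fun a ha n => (hf a ha n).trans (hM ⟨a, rfl⟩)⟩
  obtain ⟨M, hM⟩ := hM
  have hwin : window (fun i => (x i : A)) i (n + M + 1) =
      (window x i (n + M + 1)).map Subtype.val := by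
    simp [window]
  -- The window is lengthened beyond `M`, so that it cannot occur in an iterated image of a bounded
  -- letter.
  refine lang_of_infix (v := window (fun i => (x i : A)) i (n + M + 1)) ?_
    (window_infix_window _ le_rfl (by push_cast; omega))
  obtain ⟨⟨a, haS⟩, m, hm⟩ := hx _ (isFactor_window x i (n + M + 1))
  have hm := hm.map Subtype.val
  rw [map_iterate_restrict, ← hwin, pow_iterate] at hm
  obtain ha | ha := haS
  · have hper : Function.IsPeriodicPt σ.alphImage (p * (m * (k - 1))) (σ.alphC X) :=
      hp.mul_const _
    have ha' := ha
    rw [← hper.eq, mem_iterate_alphImage (alphC_subset X)] at ha'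
    obtain ⟨-, a', ⟨-, ha'⟩, haa'⟩ := ha'
    have hXm : σ.tilde^[p * m * k] X = X := by
      rw [mul_comm, Function.iterate_mul]
      exact Function.iterate_fixed hXk _
    refine lang_mono hXm.le (mem_lang_iterate_tilde.2 ⟨[a'], ha', hm.trans ?_⟩)
    obtain ⟨k, rfl⟩ := Nat.exists_eq_add_of_le' hk
    rw [show p * m * (k + 1) = p * m + p * (m * (k + 1 - 1)) by rw [Nat.add_sub_cancel]; ring,
      Function.iterate_add_apply]
    exact σ.iterate_infix _ (List.singleton_infix_iff _ _ |>.2 haa')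
  · have h₁ := hm.length_le
    have h₂ := hM a ha (p * m)
    rw [length_window] at h₁
    simp only [List.map_cons, List.map_nil] at h₁
    omega

end Substitution

theorem mainTheorem5 {A : Type*} [Finite A] [TopologicalSpace A] [DiscreteTopology A]
    (σ : Substitution A) :
    (∀ X : Set (ℤ → A), BiWord.IsSubshift X → X ⊆ σ.subshift →
      ∃ k : ℕ, 1 ≤ k ∧ σ.tilde^[k] X = X ∧
        ((σ.alphC X).Nonempty →
          σ.ArrowPow k (σ.alphC X) (σ.alphC X) ∧
          (∃ h : (σ.pow k).Preserves (σ.alphC X ∪ σ.boundedLetters),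
            (σ.pow k).restrictSubshift (σ.alphC X ∪ σ.boundedLetters) h ⊆ X) ∧
          ∃ p : ℕ, p ∣ k ∧ σ.IsPeriodicAlphabet p (σ.alphC X) ∧
            ∃ h : (σ.pow p).Preserves (σ.alphC X ∪ σ.boundedLetters),
              (σ.pow p).restrictSubshift (σ.alphC X ∪ σ.boundedLetters) h ⊆ X)) ∧
    Set.BijOn σ.tilde {X | BiWord.IsSubshift X ∧ X ⊆ σ.subshift}
      {X | BiWord.IsSubshift X ∧ X ⊆ σ.subshift} := by
  refine ⟨fun X hX hXσ => ?_, Substitution.bijOn_tilde⟩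
  obtain ⟨k, hk, h⟩ := Substitution.exists_iterate_tilde_eq_self σ
  have hXk := h X hX hXσ
  refine ⟨k, hk, hXk, fun hne => ?_⟩
  have hD := Substitution.alphC_subset (σ := σ) X
  have hper : Function.IsPeriodicPt σ.alphImage k (σ.alphC X) := by
    have := Substitution.alphC_iterate_tilde (σ := σ) X k
    rw [hXk] at this
    exact this.symm
  have hmin := Function.isPeriodicPt_minimalPeriod σ.alphImage (σ.alphC X)
  exact ⟨(Substitution.arrowPow_iff hD hne).2 hper,
    ⟨Substitution.preserves_union_boundedLetters hD hper,
      Substitution.restrictSubshift_subset hX hk hXk hper _⟩,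
    _, hper.minimalPeriod_dvd, Substitution.isPeriodicAlphabet_minimalPeriod hD hne hk hper,
    Substitution.preserves_union_boundedLetters hD hmin,
    Substitution.restrictSubshift_subset hX hk hXk hmin _⟩
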